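/- Let $n>0$ and let $W$ be a standard Brownian motion. For a square-integrable function $f$ on $[-\frac12,\frac12]$ let $E_f$ denote expectation when one observes the path $Y$ of the white noise model $$dY(t)=f(t)\,dt+\tfrac{1}{\sqrt n}\,dW(t),\qquad -\tfrac12\le t\le \tfrac12,\qquad Y(-\tfrac12)=0 .$$ Let $V$ be a real vector space of square-integrable functions on $[-\frac12,\frac12]$, let $T:V\to\mathbb R$ be a linear functional (not necessarily continuous; for example, point evaluation $Tf=f(0)$), and let $\mathcal F_1,\mathcal F_2\subseteq V$ satisfy $\mathcal F_1\cap\mathcal F_2\neq\emptyset$. For $\varepsilon\ge 0$ define the between-class modulus of continuity $$\omega_+(\varepsilon,\mathcal F_1,\mathcal F_2)=\sup\{|Tg-Tf| : \|g-f\|_2\le\varepsilon,\ f\in\mathcal F_1,\ g\in\mathcal F_2\}\in[0,\infty].$$ Let $\hat T=\hat T(Y)$ be an estimator, that is, a real-valued measurable function of the observed path, such that $$\sup_{f\in\mathcal F_1}E_f(\hat T-Tf)^2\le \gamma_n^{-2}\,\omega_+^2\Bigl(\tfrac1{\sqrt n},\mathcal F_1,\mathcal F_2\Bigr)$$ for some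 real $\gamma_n>1$. Then for every $0<\rho\le 1$, $$\sup_{f\in\mathcal F_2}\bigl[E_f(\hat T-Tf)^2\bigr]^{1/2}\ \ge\ \omega_+\Bigl(\sqrt{\tfrac{\rho\ln\gamma_n^2}{n}},\mathcal F_1,\mathcal F_2\Bigr)-\gamma_n^{-(1-\rho)}\,\omega_+\Bigl(\tfrac1{\sqrt n},\mathcal F_1,\mathcal F_2\Bigr),$$ where, if infinite quantities occur, the inequality is read with the last term added to the left-hand side. -/

import Mathlib

open MeasureTheory ProbabilityTheory
open scoped ENNReal NNReal

noncomputable section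

namespace WhiteNoise

/-- The observation interval `[-1/2, 1/2]`. -/
abbrev Interval : Type := Set.Icc (-(1 / 2) : ℝ) (1 / 2)

/-- Lebesgue measure on `[-1/2, 1/2]`. -/
instance : MeasureSpace Interval := Measure.Subtype.measureSpace

/-- The path `Y` of the white noise with drift model `dY(t) = f(t) dt + n^{-1/2} dW(t)`,
`-1/2 ≤ t ≤ 1/2`, started at `Y(-1/2) = 0`:
`Y(t) = ∫_{-1/2}^t f(s) ds + n^{-1/2} W(t + 1/2)`. -/
def observation {Ω : Type*} (W : ℝ≥0 → Ω → ℝ) (n : ℝ) (f : Interval → ℝ) (w : Ω) :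
    Interval → ℝ :=
  fun t => (∫ s in Set.Iic t, f s) + (1 / √n) * W (Real.toNNReal ((t : ℝ) + 1 / 2)) w

/-- The mean squared error `E_f (That - θ)^2` of the estimator `That`, a function of the observed
path, for estimating the number `θ` when the drift is `f`; it may be infinite. -/
def risk {Ω : Type*} [MeasurableSpace Ω] (P : Measure Ω) (W : ℝ≥0 → Ω → ℝ) (n : ℝ)
    (That : (Interval → ℝ) → ℝ) (f : Interval → ℝ) (θ : ℝ) : ℝ≥0∞ :=
  ∫⁻ w, ENNReal.ofReal ((That (observation W n f w) - θ) ^ 2) ∂P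

/-- The between-class modulus of continuity
`ω₊(ε, F₁, F₂) = sup {|T g - T f| : ‖g - f‖₂ ≤ ε, f ∈ F₁, g ∈ F₂}`, possibly infinite, of a linear
functional `T` on a vector space `V` of functions. -/
def modulusPlus {V : Submodule ℝ (Interval → ℝ)} (T : V →ₗ[ℝ] ℝ) (ε : ℝ) (F₁ F₂ : Set V) : ℝ≥0∞ :=
  ⨆ (f ∈ F₁) (g ∈ F₂)
    (_ : eLpNorm ((g : Interval → ℝ) - (f : Interval → ℝ)) 2 volume ≤ ENNReal.ofReal ε),
    ENNReal.ofReal |T g - T f|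

end WhiteNoise

end

/-!
The statement is a constrained risk inequality: an estimator that is very accurate on `F₁` cannot be
accurate on `F₂`. Take `f ∈ F₁`, `g ∈ F₂` with `‖g - f‖₂² ≤ ρ ln γ² / n`. By the triangle
inequality,
`|T g - T f| ≤ E_g |That - T g| + E_g |That - T f|`.
The first term is at most the root mean squared error at `g`. In the second, changing the drift from
`g` to `f` introduces the likelihood ratio, whose second moment under `f` is
`exp (n ‖g - f‖₂²) ≤ γ ^ (2 ρ)`, so by Cauchy–Schwarz the term is at most `γ ^ ρ` times the root mean
squared error at `f`, which is at most `γ⁻¹ ω₊(1 / √n)` by hypothesis. The supremum over all such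
pairs `f`, `g` is the claim.

The analytic content is the Cameron–Martin theorem `IsIsonormal.exists_density_shift`. It is proved
for a centred Gaussian family `X` with covariances `⟪e s, e t⟫`, where the `e t` are vectors of a
Hilbert space `H`, so that no stochastic integral is needed. For a finite linear combination `c` of
the `e t`, put `L_c = exp (c(X) - ‖c‖² / 2)`, with `c(X)` the same linear combination of the `X t`.
Gaussian exponential moments give `E[L_c L_d] = exp ⟪c, d⟫`; hence `L_c` converges in `L²` as `c`
approaches any given vector in the closed span of the `e t`
(`IsIsonormal.exists_limit_shiftDensity`). Under the limiting density the moment generating function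
of each linear combination of the `X t` is that of the shifted family, and linear combinations
determine the law of the whole process (`map_process_eq_of_forall_linearCombination`). Only the
inner products of the shift direction with the `e t` matter, so an arbitrary `u : H` is replaced by
its projection onto the closed span. Brownian motion is the case in which `e t` is the indicator of
`[-1/2, t]` in `L²`.
-/

open scoped RealInnerProductSpace Topology
open Filter

/-! ### Gaussian families indexed by vectors of a Hilbert space -/

/-- The family `X` of random variables is centred, jointly Gaussian and has the covariances
`⟪e s, e t⟫`. This is encoded by the law of each finite linear combination of the `X t`. -/
structure IsIsonormal {Ω τ H : Type*} [MeasurableSpace Ω] [NormedAddCommGroup H]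
    [InnerProductSpace ℝ H] (e : τ → H) (X : τ → Ω → ℝ) (P : Measure Ω) : Prop where
  measurable : ∀ t, Measurable (X t)
  map_eq : ∀ c : τ →₀ ℝ, P.map (Finsupp.linearCombination ℝ X c) =
    gaussianReal 0 (‖Finsupp.linearCombination ℝ e c‖₊ ^ 2)

namespace IsIsonormal

variable {Ω τ H : Type*} [MeasurableSpace Ω] [NormedAddCommGroup H] [InnerProductSpace ℝ H]
  {e : τ → H} {X : τ → Ω → ℝ} {P : Measure Ω}

lemma measurable_linearCombination (h : IsIsonormal e X P) (c : τ →₀ ℝ) :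
    Measurable (Finsupp.linearCombination ℝ X c) := by
  rw [Finsupp.linearCombination_apply, Finsupp.sum]
  convert! Finset.measurable_sum c.support fun t _ => (h.measurable t).const_smul (c t) using 1
  ext w
  simp

lemma integrable_exp (h : IsIsonormal e X P) (c : τ →₀ ℝ) :
    Integrable (fun w => Real.exp (Finsupp.linearCombination ℝ X c w)) P := by
  have h1 := integrable_exp_mul_gaussianReal (μ := 0)
    (v := ‖Finsupp.linearCombination ℝ e c‖₊ ^ 2) 1
  rw [← h.map_eq c, integrable_map_measure (by fun_prop)
    (h.measurable_linearCombination c).aemeasurable] at h1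
  simpa [Function.comp_def] using h1

lemma integral_exp (h : IsIsonormal e X P) (c : τ →₀ ℝ) :
    ∫ w, Real.exp (Finsupp.linearCombination ℝ X c w) ∂P =
      Real.exp (‖Finsupp.linearCombination ℝ e c‖ ^ 2 / 2) := by
  simpa [mgf] using mgf_gaussianReal (h.map_eq c) 1

/-- The density, with respect to `P`, of a Cameron–Martin shift of `X` along a finite linear
combination of the vectors `e t`. -/
noncomputable def shiftDensity (e : τ → H) (X : τ → Ω → ℝ) (c : τ →₀ ℝ) (w : Ω) : ℝ :=
  Real.exp (Finsupp.linearCombination ℝ X c w - ‖Finsupp.linearCombination ℝ e c‖ ^ 2 / 2)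

omit [MeasurableSpace Ω] in
lemma shiftDensity_mul_exp (c d : τ →₀ ℝ) (w : Ω) :
    shiftDensity e X c w * Real.exp (Finsupp.linearCombination ℝ X d w) =
      Real.exp (-(‖Finsupp.linearCombination ℝ e c‖ ^ 2 / 2)) *
        Real.exp (Finsupp.linearCombination ℝ X (c + d) w) := by
  rw [shiftDensity, ← Real.exp_add, ← Real.exp_add, map_add, Pi.add_apply]
  ring_nf

lemma integral_shiftDensity_mul_exp (h : IsIsonormal e X P) (c d : τ →₀ ℝ) :
    ∫ w, shiftDensity e X c w * Real.exp (Finsupp.linearCombination ℝ X d w) ∂P =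
      Real.exp (‖Finsupp.linearCombination ℝ e d‖ ^ 2 / 2 +
        ⟪Finsupp.linearCombination ℝ e c, Finsupp.linearCombination ℝ e d⟫) := by
  simp_rw [shiftDensity_mul_exp]
  rw [integral_const_mul, h.integral_exp, ← Real.exp_add, map_add, norm_add_sq_real]
  ring_nf

lemma integral_shiftDensity_mul_shiftDensity (h : IsIsonormal e X P) (c d : τ →₀ ℝ) :
    ∫ w, shiftDensity e X c w * shiftDensity e X d w ∂P =
      Real.exp ⟪Finsupp.linearCombination ℝ e c, Finsupp.linearCombination ℝ e d⟫ := by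
  have h1 : ∀ w, shiftDensity e X c w * shiftDensity e X d w =
      Real.exp (-(‖Finsupp.linearCombination ℝ e d‖ ^ 2 / 2)) *
        (shiftDensity e X c w * Real.exp (Finsupp.linearCombination ℝ X d w)) := fun w => by
    rw [shiftDensity, shiftDensity, sub_eq_add_neg _ (‖Finsupp.linearCombination ℝ e d‖ ^ 2 / 2),
      Real.exp_add _ (-(‖Finsupp.linearCombination ℝ e d‖ ^ 2 / 2))]
    ring
  simp_rw [h1]
  rw [integral_const_mul, h.integral_shiftDensity_mul_exp, ← Real.exp_add]
  ring_nf

lemma memLp_exp (h : IsIsonormal e X P) (c : τ →₀ ℝ) :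
    MemLp (fun w => Real.exp (Finsupp.linearCombination ℝ X c w)) 2 P := by
  rw [memLp_two_iff_integrable_sq (h.measurable_linearCombination c).exp.aestronglyMeasurable]
  refine (h.integrable_exp ((2 : ℝ) • c)).congr (.of_forall fun w => ?_)
  simp [← Real.exp_nat_mul]

lemma memLp_shiftDensity (h : IsIsonormal e X P) (c : τ →₀ ℝ) :
    MemLp (shiftDensity e X c) 2 P := by
  refine ((h.memLp_exp c).const_mul
    (Real.exp (-(‖Finsupp.linearCombination ℝ e c‖ ^ 2 / 2)))).ae_eq (.of_forall fun w => ?_)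
  rw [shiftDensity, ← Real.exp_add]
  ring_nf

/-- The `L²` inner product of two classes is the integral of the product. -/
lemma inner_toLp {f g : Ω → ℝ} (hf : MemLp f 2 P) (hg : MemLp g 2 P) :
    ⟪hf.toLp f, hg.toLp g⟫ = ∫ w, f w * g w ∂P := by
  rw [L2.inner_def]
  refine integral_congr_ae ?_
  filter_upwards [hf.coeFn_toLp, hg.coeFn_toLp] with w h1 h2
  rw [h1, h2, RCLike.inner_apply, conj_trivial, mul_comm]

/-- The densities of shifts along linear combinations converge in `L²(P)` when the shifts converge
in `H`, because `E[L_c L_d] = exp ⟪c, d⟫`. -/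
lemma exists_limit_shiftDensity (h : IsIsonormal e X P) {p : H}
    (hp : p ∈ closure (Set.range (Finsupp.linearCombination ℝ e))) :
    ∃ L : Lp ℝ 2 P, 0 ≤ L ∧ ‖L‖ ^ 2 = Real.exp (‖p‖ ^ 2) ∧
      ∀ d : τ →₀ ℝ, ∫ w, L w * Real.exp (Finsupp.linearCombination ℝ X d w) ∂P =
        Real.exp (‖Finsupp.linearCombination ℝ e d‖ ^ 2 / 2 +
          ⟪p, Finsupp.linearCombination ℝ e d⟫) := by
  obtain ⟨v, hv, hvp⟩ := mem_closure_iff_seq_limit.1 hp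
  choose c hc using hv
  obtain rfl : (fun k => Finsupp.linearCombination ℝ e (c k)) = v := funext hc
  let L : ℕ → Lp ℝ 2 P := fun k => (h.memLp_shiftDensity (c k)).toLp _
  have hinner : ∀ k m, ⟪L k, L m⟫ = Real.exp
      ⟪Finsupp.linearCombination ℝ e (c k), Finsupp.linearCombination ℝ e (c m)⟫ := fun k m => by
    rw [inner_toLp, h.integral_shiftDensity_mul_shiftDensity]
  have hcauchy : CauchySeq L := by
    -- `‖L k - L m‖² = exp ⟪v k, v k⟫ - 2 exp ⟪v k, v m⟫ + exp ⟪v m, v m⟫ → 0`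
    -- for the linear combinations `v k` that converge to `p`
    rw [cauchySeq_iff_tendsto_dist_atTop_0]
    have h1 := hvp.comp (tendsto_fst (f := (atTop : Filter ℕ)) (g := (atTop : Filter ℕ)))
    have h2 := hvp.comp (tendsto_snd (f := (atTop : Filter ℕ)) (g := (atTop : Filter ℕ)))
    have h3 := Real.continuous_sqrt.continuousAt.tendsto.comp
      ((((h1.inner h1).rexp).sub (((h1.inner h2).rexp).const_mul 2)).add ((h2.inner h2).rexp))
    rw [prod_atTop_atTop_eq] at h3
    convert h3 using 1
    · ext ⟨k, m⟩
      simp only [Function.comp, dist_eq_norm]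
      rw [← Real.sqrt_sq (norm_nonneg (L k - L m)), norm_sub_sq_real,
        ← real_inner_self_eq_norm_sq, ← real_inner_self_eq_norm_sq, hinner, hinner, hinner]
    · rw [show ∀ x : ℝ, x - 2 * x + x = 0 from fun x => by ring, Real.sqrt_zero]
  obtain ⟨M, hM⟩ := cauchySeq_tendsto_of_complete hcauchy
  refine ⟨M, ?_, ?_, fun d => ?_⟩
  · refine ge_of_tendsto' hM fun k => ?_
    rw [← Lp.coeFn_nonneg]
    filter_upwards [(h.memLp_shiftDensity (c k)).coeFn_toLp] with w hw
    rw [hw]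
    exact (Real.exp_pos _).le
  · rw [← real_inner_self_eq_norm_sq, ← real_inner_self_eq_norm_sq]
    refine tendsto_nhds_unique (hM.inner hM) ?_
    simp_rw [hinner]
    exact (hvp.inner hvp).rexp
  · have hd := h.memLp_exp d
    have hk : ∀ N : Lp ℝ 2 P, ⟪N, hd.toLp _⟫ =
        ∫ w, N w * Real.exp (Finsupp.linearCombination ℝ X d w) ∂P := fun N => by
      conv_lhs => rw [← Lp.toLp_coeFn N (Lp.memLp N)]
      rw [inner_toLp]
    rw [← hk]
    refine tendsto_nhds_unique (hM.inner tendsto_const_nhds) ?_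
    simp_rw [L, inner_toLp, h.integral_shiftDensity_mul_exp]
    exact ((hvp.inner tendsto_const_nhds).const_add _).rexp

end IsIsonormal

/-! ### Uniqueness of laws -/

/-- A law with finite exponential moments is determined by its moment generating function. -/
lemma map_eq_of_mgf_eq {Ω Ω' : Type*} [MeasurableSpace Ω] [MeasurableSpace Ω'] {μ : Measure Ω}
    {ν : Measure Ω'} [IsProbabilityMeasure μ] [IsFiniteMeasure ν] {X : Ω → ℝ} {Y : Ω' → ℝ}
    (hX : Measurable X) (hY : Measurable Y)
    (hint : ∀ s : ℝ, Integrable (fun w => Real.exp (s * X w)) μ) (h : mgf X μ = mgf Y ν) :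
    μ.map X = ν.map Y := by
  refine Measure.ext_of_complexMGF_eq hX.aemeasurable hY.aemeasurable (funext fun z => ?_)
  refine eqOn_complexMGF_of_mgf h ?_
  have huniv : integrableExpSet X μ = Set.univ := Set.eq_univ_of_forall hint
  simp [huniv]

/-- Two processes, possibly under different measures, have the same law if all finite linear
combinations of their values have the same law. -/
lemma map_process_eq_of_forall_linearCombination {Ω τ : Type*} [MeasurableSpace Ω]
    {μ ν : Measure Ω} [IsFiniteMeasure μ] [IsFiniteMeasure ν] {X Y : τ → Ω → ℝ}
    (hX : ∀ t, Measurable (X t)) (hY : ∀ t, Measurable (Y t))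
    (h : ∀ c : τ →₀ ℝ, μ.map (Finsupp.linearCombination ℝ X c) =
      ν.map (Finsupp.linearCombination ℝ Y c)) :
    μ.map (fun w t => X t w) = ν.map (fun w t => Y t w) := by
  have hX' : Measurable fun w t => X t w := measurable_pi_lambda _ hX
  have hY' : Measurable fun w t => Y t w := measurable_pi_lambda _ hY
  refine IsProjectiveLimit.unique (P := fun I => μ.map fun w => I.restrict fun t => X t w)
    (isProjectiveLimit_map hX'.aemeasurable) fun I => ?_
  rw [isProjectiveLimit_map hY'.aemeasurable I]
  have hXI : Measurable fun w => I.restrict fun t => X t w := by fun_prop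
  have hYI : Measurable fun w => I.restrict fun t => Y t w := by fun_prop
  refine Measure.ext_of_charFunDual (funext fun ℓ => ?_)
  rw [charFunDual_eq_charFun_map_one, charFunDual_eq_charFun_map_one,
    Measure.map_map (by fun_prop) hYI, Measure.map_map (by fun_prop) hXI]
  classical
  -- a functional of finitely many coordinates is a linear combination of them
  have key : ∀ Z : τ → Ω → ℝ, (ℓ ∘ fun w => I.restrict fun t => Z t w) =
      Finsupp.linearCombination ℝ Z
        (∑ i : I, Finsupp.single (i : τ) (ℓ (Pi.single i 1))) := fun Z => by
    ext w
    simp only [Function.comp, map_sum, Finsupp.linearCombination_single, Finset.sum_apply,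
      Pi.smul_apply, smul_eq_mul]
    have := LinearMap.pi_apply_eq_sum_univ ℓ.toLinearMap (I.restrict fun t => Z t w)
    simp only [ContinuousLinearMap.coe_coe] at this
    rw [this]
    refine Finset.sum_congr rfl fun i _ => ?_
    rw [smul_eq_mul, mul_comm, Finset.restrict_def]
    congr 2
    ext j
    simp [Pi.single_apply, eq_comm]
  rw [key Y, key X, h]

/-! ### The Cameron–Martin theorem -/

namespace IsIsonormal

variable {Ω τ H : Type*} [MeasurableSpace Ω] [NormedAddCommGroup H] [InnerProductSpace ℝ H]
  {e : τ → H} {X : τ → Ω → ℝ} {P : Measure Ω}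

/-- **Cameron–Martin**: the shift of the process `X` by `t ↦ ⟪u, e t⟫` has the law of `X` under a
measure with a density whose second moment is at most `exp ‖u‖²`. -/
theorem exists_density_shift [CompleteSpace H] [IsProbabilityMeasure P] (h : IsIsonormal e X P)
    (u : H) :
    ∃ D : Ω → ℝ≥0∞, Measurable D ∧ ∫⁻ w, D w ^ 2 ∂P ≤ ENNReal.ofReal (Real.exp (‖u‖ ^ 2)) ∧
      (P.withDensity D).map (fun w t => X t w) = P.map (fun w t => X t w + ⟪u, e t⟫) := by
  -- The shift depends on `u` only through its projection `p` onto the closed span of the `e t`.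
  let K : Submodule ℝ H := (LinearMap.range (Finsupp.linearCombination ℝ e)).topologicalClosure
  have : CompleteSpace K := (Submodule.isClosed_topologicalClosure _).completeSpace_coe
  let p : H := K.starProjection u
  have hpK : p ∈ closure (Set.range (Finsupp.linearCombination ℝ e)) := by
    simpa only [K, ← SetLike.mem_coe, Submodule.topologicalClosure_coe, LinearMap.coe_range]
      using K.starProjection_apply_mem u
  have hpu : ∀ d : τ →₀ ℝ, ⟪p, Finsupp.linearCombination ℝ e d⟫ =
      ⟪u, Finsupp.linearCombination ℝ e d⟫ := fun d => by
    have := K.starProjection_inner_eq_zero u (Finsupp.linearCombination ℝ e d)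
      (Submodule.le_topologicalClosure _ (LinearMap.mem_range_self _ d))
    rw [inner_sub_left] at this
    linarith
  obtain ⟨L, hL0, hLnorm, hL⟩ := h.exists_limit_shiftDensity hpK
  have hLm : StronglyMeasurable L := Lp.stronglyMeasurable L
  have hLnn : ∀ᵐ w ∂P, 0 ≤ L w := (Lp.coeFn_nonneg L).2 hL0
  let D : Ω → ℝ≥0∞ := fun w => ENNReal.ofReal (L w)
  have hD : Measurable D := hLm.measurable.ennreal_ofReal
  have hDint : ∀ g : Ω → ℝ, ∫ w, g w ∂P.withDensity D = ∫ w, L w * g w ∂P := fun g => by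
    rw [integral_withDensity_eq_integral_toReal_smul hD (.of_forall fun _ => ENNReal.ofReal_lt_top)]
    refine integral_congr_ae ?_
    filter_upwards [hLnn] with w hw
    simp [D, ENNReal.toReal_ofReal hw]
  -- the case `d = 0` of `hL` is the total mass
  have hmass : ∫⁻ w, D w ∂P = 1 := by
    have h0 := hL 0
    simp only [map_zero, Pi.zero_apply, Real.exp_zero, mul_one, norm_zero, inner_zero_right] at h0
    rw [← ofReal_integral_eq_lintegral_ofReal ((Lp.memLp L).integrable one_le_two) hLnn, h0]
    simp
  have : IsProbabilityMeasure (P.withDensity D) := ⟨by simpa using hmass⟩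
  refine ⟨D, hD, ?_, ?_⟩
  · have hle : ‖L‖ ^ 2 ≤ Real.exp (‖u‖ ^ 2) := by
      rw [hLnorm]
      gcongr
      exact K.norm_starProjection_apply_le u
    refine le_trans (le_of_eq ?_) (ENNReal.ofReal_le_ofReal hle)
    have hsq : ‖L‖ ^ 2 = ∫ w, L w ^ 2 ∂P := by
      rw [← real_inner_self_eq_norm_sq, L2.inner_def]
      simp [sq]
    rw [hsq, ofReal_integral_eq_lintegral_ofReal (Lp.memLp L).integrable_sq
      (.of_forall fun w => sq_nonneg _)]
    refine lintegral_congr_ae ?_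
    filter_upwards [hLnn] with w hw
    rw [ENNReal.ofReal_pow hw]
  · refine map_process_eq_of_forall_linearCombination h.measurable
      (fun t => (h.measurable t).add_const _) fun d => ?_
    have hshift : Finsupp.linearCombination ℝ (fun t w => X t w + ⟪u, e t⟫) d =
        fun w => Finsupp.linearCombination ℝ X d w + ⟪u, Finsupp.linearCombination ℝ e d⟫ := by
      ext w
      simp [Finsupp.linearCombination_apply, Finsupp.sum, inner_sum, inner_smul_right, mul_add,
        Finset.sum_add_distrib]
    have hscale : ∀ (s : ℝ) w, s * Finsupp.linearCombination ℝ X d w =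
        Finsupp.linearCombination ℝ X (s • d) w := fun s w => by simp
    have hm := h.measurable_linearCombination d
    rw [hshift]
    refine map_eq_of_mgf_eq hm (hm.add_const _) (fun s => ?_) (funext fun s => ?_)
    · refine (integrable_withDensity_iff_integrable_smul' hD
        (.of_forall fun _ => ENNReal.ofReal_lt_top)).2 ?_
      simp_rw [hscale]
      refine ((Lp.memLp L).integrable_mul (h.memLp_exp (s • d))).congr ?_
      filter_upwards [hLnn] with w hw
      simp [D, ENNReal.toReal_ofReal hw]
    · rw [mgf, mgf, hDint]
      simp_rw [mul_add, Real.exp_add]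
      rw [integral_mul_const]
      simp_rw [hscale]
      rw [hL, h.integral_exp, hpu, ← Real.exp_add, map_smul, inner_smul_right]

/-- Cauchy–Schwarz applied to the Cameron–Martin density. -/
theorem lintegral_shift_le [CompleteSpace H] [IsProbabilityMeasure P] (h : IsIsonormal e X P)
    (u : H) {φ : (τ → ℝ) → ℝ≥0∞} (hφ : Measurable φ) :
    ∫⁻ w, φ (fun t => X t w + ⟪u, e t⟫) ∂P ≤
      ENNReal.ofReal (Real.exp (‖u‖ ^ 2 / 2)) *
        (∫⁻ w, φ (fun t => X t w) ^ 2 ∂P) ^ (1 / 2 : ℝ) := by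
  obtain ⟨D, hD, hD2, hmap⟩ := h.exists_density_shift u
  have hX : Measurable fun w t => X t w := measurable_pi_lambda _ h.measurable
  have hXu : Measurable fun w t => X t w + ⟪u, e t⟫ :=
    measurable_pi_lambda _ fun t => (h.measurable t).add_const _
  rw [← lintegral_map (f := φ) hφ hXu, ← hmap, lintegral_map hφ hX]
  rw [lintegral_withDensity_eq_lintegral_mul _ hD (g := fun w => φ fun t => X t w) (hφ.comp hX)]
  refine (ENNReal.lintegral_mul_le_Lp_mul_Lq P Real.HolderConjugate.two_two hD.aemeasurable
    (hφ.comp hX).aemeasurable).trans ?_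
  simp only [ENNReal.rpow_two, Function.comp]
  gcongr
  calc (∫⁻ w, D w ^ 2 ∂P) ^ (1 / 2 : ℝ)
      ≤ ENNReal.ofReal (Real.exp (‖u‖ ^ 2)) ^ (1 / 2 : ℝ) := by gcongr
    _ = ENNReal.ofReal (Real.exp (‖u‖ ^ 2 / 2)) := by
      rw [ENNReal.ofReal_rpow_of_pos (Real.exp_pos _), ← Real.exp_mul]
      ring_nf

end IsIsonormal

/-! ### The white noise model -/

namespace WhiteNoise

lemma volume_Iic (t : Interval) :
    (volume : Measure Interval) (Set.Iic t) = ENNReal.ofReal ((t : ℝ) + 1 / 2) := by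
  change Measure.comap Subtype.val volume (Set.Iic t) = _
  rw [comap_subtype_coe_apply measurableSet_Icc]
  have : Subtype.val '' Set.Iic t = Set.Icc (-(1 / 2) : ℝ) t := by
    ext x
    constructor
    · rintro ⟨y, hy, rfl⟩
      exact ⟨y.2.1, hy⟩
    · exact fun hx => ⟨⟨x, hx.1, hx.2.trans t.2.2⟩, hx.2, rfl⟩
  rw [this, Real.volume_Icc]
  ring_nf

instance : IsFiniteMeasure (volume : Measure Interval) where
  measure_univ_lt_top := by
    have h := volume_Iic ⟨1 / 2, by norm_num⟩
    have huniv : Set.Iic (⟨1 / 2, by norm_num⟩ : Interval) = Set.univ :=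
      Set.eq_univ_of_forall fun x => x.2.2
    rw [← huniv, h]
    exact ENNReal.ofReal_lt_top

/-- The class in `L²` of the indicator function of `[-1/2, t]`. -/
noncomputable def indicatorIic (t : Interval) : Lp ℝ 2 (volume : Measure Interval) :=
  indicatorConstLp 2 (measurableSet_Iic : MeasurableSet (Set.Iic t)) (measure_ne_top _ _) 1

/-- The Brownian motion `W` with time shifted so that it starts at time `-1/2`. -/
noncomputable def shiftedProcess {Ω : Type*} (W : ℝ≥0 → Ω → ℝ) (t : Interval) : Ω → ℝ :=
  W (Real.toNNReal ((t : ℝ) + 1 / 2))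

lemma inner_indicatorIic (s t : Interval) :
    ⟪indicatorIic s, indicatorIic t⟫ =
      min (Real.toNNReal ((s : ℝ) + 1 / 2)) (Real.toNNReal ((t : ℝ) + 1 / 2)) := by
  rw [indicatorIic, indicatorIic, L2.real_inner_indicatorConstLp_one_indicatorConstLp_one,
    Set.Iic_inter_Iic, measureReal_def, volume_Iic]
  have h : Monotone fun x : ℝ => Real.toNNReal (x + 1 / 2) := fun x y hxy =>
    Real.toNNReal_le_toNNReal (by linarith)
  rw [← h.map_min]
  rfl

lemma isIsonormal_shiftedProcess {Ω : Type*} [MeasurableSpace Ω] {P : Measure Ω}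
    {W : ℝ≥0 → Ω → ℝ} (hW : IsPreBrownianReal W P) (hWmeas : ∀ t, Measurable (W t)) :
    IsIsonormal indicatorIic (shiftedProcess W) P where
  measurable t := hWmeas _
  map_eq c := by
    have hprocess : IsGaussianProcess (shiftedProcess W) P :=
      hW.isGaussianProcess.comp_right fun t : Interval => Real.toNNReal ((t : ℝ) + 1 / 2)
    have := hprocess.isProbabilityMeasure
    have hmem : ∀ t, MemLp (shiftedProcess W t) 2 P := fun t =>
      (hprocess.hasGaussianLaw_eval t).memLp_two
    have hlaw : HasGaussianLaw (Finsupp.linearCombination ℝ (shiftedProcess W) c) P :=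
      (hprocess.smul c).hasGaussianLaw_sum (I := c.support)
    have hmean : ∫ w, Finsupp.linearCombination ℝ (shiftedProcess W) c w ∂P = 0 := by
      simp only [Finsupp.linearCombination_apply, Finsupp.sum, Finset.sum_apply, Pi.smul_apply,
        smul_eq_mul]
      rw [integral_finsetSum _ fun t _ => ((hmem t).integrable one_le_two).const_mul _]
      refine Finset.sum_eq_zero fun t _ => ?_
      rw [integral_const_mul, shiftedProcess, hW.integral_eval, mul_zero]
    have hvar : Var[Finsupp.linearCombination ℝ (shiftedProcess W) c; P] =
        ‖Finsupp.linearCombination ℝ indicatorIic c‖ ^ 2 := by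
      simp only [Finsupp.linearCombination_apply, Finsupp.sum]
      rw [variance_sum' fun t _ => (hmem t).const_smul (c t), ← real_inner_self_eq_norm_sq,
        sum_inner]
      refine Finset.sum_congr rfl fun s _ => ?_
      rw [inner_sum]
      refine Finset.sum_congr rfl fun t _ => ?_
      rw [covariance_smul_left, covariance_smul_right, inner_smul_left, inner_smul_right,
        inner_indicatorIic, shiftedProcess, shiftedProcess, hW.covariance_eval]
      simp
    rw [hlaw.map_eq_gaussianReal, hmean, hvar]
    congr 1
    ext
    simp

lemma inner_toLp_indicatorIic {f : Interval → ℝ} (hf : MemLp f 2 volume) (t : Interval) :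
    ⟪hf.toLp f, indicatorIic t⟫ = ∫ s in Set.Iic t, f s := by
  rw [real_inner_comm, indicatorIic, L2.inner_indicatorConstLp_one]
  exact setIntegral_congr_ae₀ measurableSet_Iic.nullMeasurableSet
    (hf.coeFn_toLp.mono fun _ h _ => h)

/-- The path under drift `g` is an affine image of a Cameron–Martin shift of the Brownian path; the
affine map is the one that yields the path under drift `f`. -/
lemma observation_eq_shift {Ω : Type*} (W : ℝ≥0 → Ω → ℝ) {n : ℝ} (hn : 0 < n)
    {f g : Interval → ℝ} (hf : MemLp f 2 volume) (hg : MemLp g 2 volume) (w : Ω) :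
    observation W n g w = fun t => (∫ s in Set.Iic t, f s) + (1 / √n) *
      (shiftedProcess W t w + ⟪√n • (hg.sub hf).toLp (g - f), indicatorIic t⟫) := by
  ext t
  have hn' : √n ≠ 0 := (Real.sqrt_pos.2 hn).ne'
  rw [real_inner_smul_left, inner_toLp_indicatorIic, observation, shiftedProcess]
  simp only [Pi.sub_apply]
  rw [integral_sub (hg.integrable one_le_two).integrableOn (hf.integrable one_le_two).integrableOn]
  field_simp
  ring

lemma measurable_observation {Ω : Type*} [MeasurableSpace Ω] {W : ℝ≥0 → Ω → ℝ}
    (hWmeas : ∀ t, Measurable (W t)) (n : ℝ) (f : Interval → ℝ) :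
    Measurable (observation W n f) :=
  measurable_pi_lambda _ fun _ => ((hWmeas _).const_mul _).const_add _

/-- The mean absolute error is at most the root mean squared error. -/
lemma lintegral_abs_le_risk {Ω : Type*} [MeasurableSpace Ω] (P : Measure Ω) [IsProbabilityMeasure P]
    {W : ℝ≥0 → Ω → ℝ} (hWmeas : ∀ t, Measurable (W t)) (n : ℝ) {That : (Interval → ℝ) → ℝ}
    (hThat : Measurable That) (f : Interval → ℝ) (θ : ℝ) :
    ∫⁻ w, ENNReal.ofReal |That (observation W n f w) - θ| ∂P ≤
      risk P W n That f θ ^ (1 / 2 : ℝ) := by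
  have hm : Measurable fun w => ENNReal.ofReal |That (observation W n f w) - θ| :=
    ((hThat.comp (measurable_observation hWmeas n f)).sub_const θ).abs.ennreal_ofReal
  have := ENNReal.lintegral_mul_le_Lp_mul_Lq P Real.HolderConjugate.two_two hm.aemeasurable
    (aemeasurable_const (b := (1 : ℝ≥0∞)))
  simpa [risk, ← ENNReal.ofReal_pow] using this

/-- The constrained risk inequality: if the mean squared error at drift `f` is small, the mean
absolute deviation of the estimator from the same number remains controlled at a nearby drift `g`,
because the likelihood ratio has second moment `exp (n ‖g - f‖²)`. -/
lemma lintegral_abs_le_exp_mul_risk {Ω : Type*} [MeasurableSpace Ω] (P : Measure Ω)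
    [IsProbabilityMeasure P] {W : ℝ≥0 → Ω → ℝ} (hW : IsPreBrownianReal W P)
    (hWmeas : ∀ t, Measurable (W t)) {n : ℝ} (hn : 0 < n) {That : (Interval → ℝ) → ℝ}
    (hThat : Measurable That) {f g : Interval → ℝ} (hf : MemLp f 2 volume)
    (hg : MemLp g 2 volume) (θ : ℝ) :
    ∫⁻ w, ENNReal.ofReal |That (observation W n g w) - θ| ∂P ≤
      ENNReal.ofReal (Real.exp (n * ‖(hg.sub hf).toLp (g - f)‖ ^ 2 / 2)) *
        risk P W n That f θ ^ (1 / 2 : ℝ) := by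
  let φ : (Interval → ℝ) → ℝ≥0∞ := fun x =>
    ENNReal.ofReal |That (fun t => (∫ s in Set.Iic t, f s) + (1 / √n) * x t) - θ|
  have hφ : Measurable φ := by
    have : Measurable fun (x : Interval → ℝ) t => (∫ s in Set.Iic t, f s) + (1 / √n) * x t :=
      measurable_pi_lambda _ fun t => ((measurable_pi_apply t).const_mul _).const_add _
    exact ((hThat.comp this).sub_const θ).abs.ennreal_ofReal
  have h := (isIsonormal_shiftedProcess hW hWmeas).lintegral_shift_le
    (√n • (hg.sub hf).toLp (g - f)) hφ
  rw [norm_smul, mul_pow, Real.norm_of_nonneg (Real.sqrt_nonneg n), Real.sq_sqrt hn.le] at h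
  simp_rw [observation_eq_shift W hn hf hg]
  refine h.trans_eq ?_
  congr 2
  refine lintegral_congr fun w => ?_
  simp only [φ]
  rw [← ENNReal.ofReal_pow (abs_nonneg _), sq_abs]
  rfl

end WhiteNoise

/-! ### The lower bound on the risk -/

theorem theorem2
    -- a Brownian motion
    {Ω : Type*} [MeasurableSpace Ω] (P : Measure Ω) [IsProbabilityMeasure P]
    (W : ℝ≥0 → Ω → ℝ) (hW : IsBrownianReal W P) (hWmeas : ∀ t, Measurable (W t))
    -- a linear functional `T` on a vector space of square integrable functions
    (V : Submodule ℝ (WhiteNoise.Interval → ℝ))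
    (hV : ∀ f ∈ V, MemLp f 2 (volume : Measure WhiteNoise.Interval))
    (T : V →ₗ[ℝ] ℝ)
    -- two function classes
    (F₁ F₂ : Set V) (hF : (F₁ ∩ F₂).Nonempty)
    -- an estimator based on the white noise data
    (n : ℝ) (hn : 0 < n)
    (That : (WhiteNoise.Interval → ℝ) → ℝ) (hThat : Measurable That)
    (γ : ℝ) (hγ : 1 < γ)
    (hrisk : ⨆ f ∈ F₁, WhiteNoise.risk P W n That f (T f) ≤
      ENNReal.ofReal (γ ^ (-2 : ℤ)) * WhiteNoise.modulusPlus T (1 / √n) F₁ F₂ ^ 2)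
    (ρ : ℝ) (hρ0 : 0 < ρ) (hρ1 : ρ ≤ 1) :
    -- the subtracted term is moved to the right-hand side, as the moduli may be infinite
    WhiteNoise.modulusPlus T (√(ρ * Real.log (γ ^ 2) / n)) F₁ F₂ ≤
      (⨆ f ∈ F₂, WhiteNoise.risk P W n That f (T f) ^ (1 / 2 : ℝ)) +
        ENNReal.ofReal (γ ^ (-(1 - ρ))) * WhiteNoise.modulusPlus T (1 / √n) F₁ F₂ := by
  set ω₁ := WhiteNoise.modulusPlus T (1 / √n) F₁ F₂
  have hγ0 : 0 < γ := one_pos.trans hγ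
  refine iSup₂_le fun f hf => iSup₂_le fun g hg => iSup_le fun hfg => ?_
  have hf2 := hV f f.2
  have hg2 := hV g g.2
  -- the root mean squared error at `f` is at most `γ⁻¹ ω₊(1 / √n)`
  have hriskf : WhiteNoise.risk P W n That f (T f) ^ (1 / 2 : ℝ) ≤
      ENNReal.ofReal (γ ^ (-1 : ℝ)) * ω₁ := by
    have h1 := (le_iSup₂ (f := fun (f : V) (_ : f ∈ F₁) =>
      WhiteNoise.risk P W n That f (T f)) f hf).trans hrisk
    calc WhiteNoise.risk P W n That f (T f) ^ (1 / 2 : ℝ)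
        ≤ (ENNReal.ofReal (γ ^ (-2 : ℤ)) * ω₁ ^ 2) ^ (1 / 2 : ℝ) := by gcongr
      _ = ENNReal.ofReal (γ ^ (-1 : ℝ)) * ω₁ := by
        rw [ENNReal.mul_rpow_of_nonneg _ _ (by norm_num), ENNReal.ofReal_rpow_of_pos (by positivity),
          ← ENNReal.rpow_two, ← ENNReal.rpow_mul, ← Real.rpow_intCast, ← Real.rpow_mul hγ0.le]
        norm_num
  -- the likelihood ratio factor is at most `γ ^ ρ`
  have hfactor : Real.exp (n * ‖(hg2.sub hf2).toLp
      ((g : WhiteNoise.Interval → ℝ) - (f : WhiteNoise.Interval → ℝ))‖ ^ 2 / 2) ≤ γ ^ ρ := by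
    have hlog : 0 ≤ ρ * Real.log (γ ^ 2) / n := by
      have := Real.log_nonneg (one_le_pow₀ hγ.le : 1 ≤ γ ^ 2)
      positivity
    have hnorm : ‖(hg2.sub hf2).toLp
        ((g : WhiteNoise.Interval → ℝ) - (f : WhiteNoise.Interval → ℝ))‖ ≤
        √(ρ * Real.log (γ ^ 2) / n) := by
      rw [Lp.norm_toLp]
      exact ENNReal.toReal_le_of_le_ofReal (Real.sqrt_nonneg _) hfg
    have hsq := pow_le_pow_left₀ (norm_nonneg _) hnorm 2
    rw [Real.sq_sqrt hlog, le_div_iff₀ hn, Real.log_pow] at hsq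
    rw [Real.rpow_def_of_pos hγ0, Real.exp_le_exp]
    push_cast at hsq
    linarith
  have hWpre := hW.toIsPreBrownianReal
  have hYm := (hThat.comp (WhiteNoise.measurable_observation hWmeas n g)).sub_const (T g)
  calc ENNReal.ofReal |T g - T f|
      = ∫⁻ _, ENNReal.ofReal |T g - T f| ∂P := by simp
    _ ≤ ∫⁻ w, (ENNReal.ofReal |That (WhiteNoise.observation W n g w) - T g| +
          ENNReal.ofReal |That (WhiteNoise.observation W n g w) - T f|) ∂P := by
        refine lintegral_mono fun w => ?_
        rw [← ENNReal.ofReal_add (abs_nonneg _) (abs_nonneg _)]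
        refine ENNReal.ofReal_le_ofReal ?_
        rw [abs_sub_comm _ (T g)]
        exact abs_sub_le _ _ _
    _ = ∫⁻ w, ENNReal.ofReal |That (WhiteNoise.observation W n g w) - T g| ∂P +
          ∫⁻ w, ENNReal.ofReal |That (WhiteNoise.observation W n g w) - T f| ∂P :=
        lintegral_add_left hYm.abs.ennreal_ofReal _
    _ ≤ WhiteNoise.risk P W n That g (T g) ^ (1 / 2 : ℝ) +
          ENNReal.ofReal (γ ^ ρ) * (ENNReal.ofReal (γ ^ (-1 : ℝ)) * ω₁) := by
        gcongr
        · exact WhiteNoise.lintegral_abs_le_risk P hWmeas n hThat g (T g)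
        · refine (WhiteNoise.lintegral_abs_le_exp_mul_risk P hWpre hWmeas hn hThat hf2 hg2
            (T f)).trans ?_
          gcongr
    _ ≤ _ := by
        refine add_le_add ?_ (le_of_eq ?_)
        · exact le_iSup₂ (f := fun (f : V) (_ : f ∈ F₂) =>
            WhiteNoise.risk P W n That f (T f) ^ (1 / 2 : ℝ)) g hg
        · rw [← mul_assoc, ← ENNReal.ofReal_mul (by positivity), ← Real.rpow_add hγ0]
          ring_nf
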